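/- Let $\Bbbk$ be a commutative unital ring, $A$ a unital associative $\Bbbk$-algebra, $\Omega_d^\bullet$ an exterior algebra over $A$ (a differential graded $\Bbbk$-algebra with $\Omega_d^0=A$, generated by $A$ and $dA$), and $E$ a left $A$-module. Let $J_d^nE$ be the holonomic $n$-jet module of $E$ with prolongation $j_d^n\colon E\to J_d^nE$: $J_d^0E=E$, $J_d^1E=J_d^1A\otimes_AE$ with $J_d^1A=(A\otimes A)/\{\sum_i a_i\otimes b_i:\sum_i a_ib_i=0,\ \sum_i a_i\,db_i=0\}$, and, for $n\ge 2$, $J_d^nE$ is the kernel of the composite $J_d^1J_d^{n-1}E\to J_d^1J_d^1J_d^{n-2}E\to(\Omega_d^1\ltimes\Omega_d^2)\otimes_A J_d^{n-2}E$, where the first map is $J_d^1$ of the canonical map $J_d^{n-1}E\to J_d^1J_d^{n-2}E$ and the second is $[a\otimes b]\otimes[c\otimes e]\mapsto(a\,d(bc)+da\wedge d(bc))\otimes e$; here $\Omega_d^1\ltimes\Omega_d^2$ has left action $f(\alpha+\beta)=f\alpha+df\wedge\alpha+f\beta$ and componentwise right action. Let $\mathrm{Diff}^n=\mathrm{Diff}^n_d(E,E)$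 be the $\Bbbk$-linear maps $E\to E$ of the form $\widetilde\Delta\circ j_d^n$ with $\widetilde\Delta\colon J_d^nE\to E$ $A$-linear, let $\mathrm{Symb}^n=\mathrm{Diff}^n/\mathrm{Diff}^{n-1}$ (with $\mathrm{Diff}^{-1}=0$), $\varsigma^n\colon\mathrm{Diff}^n\to\mathrm{Symb}^n$ the projection, $\mathrm{Symb}^\bullet=\bigoplus_n\mathrm{Symb}^n$, and let $\varsigma^n(\Delta)\cdot\varsigma^m(\Delta')=\varsigma^{n+m}(\Delta\circ\Delta')$ be the symbol product. Let $q$ be a full quantization for $(E,E)$: a family of left ${}_A\mathrm{Hom}(E,E)$-linear maps $q^n\colon\mathrm{Symb}^n\to\mathrm{Diff}^n$ with $\varsigma^n\circ q^n=\mathrm{id}$ for all $n\ge 0$. For $\Delta\in\mathrm{Diff}^N$ put $\Delta_j=\Delta$ for $j\ge N$ and, recursively, $\Delta_j=\Delta_{j+1}-q^{j+1}(\varsigma^{j+1}(\Delta_{j+1}))\in\mathrm{Diff}^j$ for $0\le j<N$; set $[\Delta]^j=\varsigma^j(\Delta_j)$. For $a\in\mathrm{Symb}^n$, $b\in\mathrm{Symb}^m$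 let $$a\mathbin{\hat\star}b=\sum_{i=0}^{n+m}h^i\,[q^n(a)\circ q^m(b)]^{\,n+m-i}\in\mathrm{Symb}^\bullet[h]=\mathrm{Symb}^\bullet\otimes\Bbbk[h],$$ extended $\Bbbk[h]$-bilinearly to $\mathrm{Symb}^\bullet[h]$; for $\hbar\in\Bbbk$ let $\star_\hbar$ be the $\Bbbk$-bilinear product $a\star_\hbar b=\mathrm{ev}_\hbar(a\mathbin{\hat\star}b)$ on $\mathrm{Symb}^\bullet$, where $\mathrm{ev}_\hbar$ substitutes $h=\hbar$. Then: 1. $(\mathrm{Symb}^\bullet[h],\hat\star)$ is a unital associative $\Bbbk[h]$-algebra with unit $\mathrm{id}_E\in\mathrm{Symb}^0$, filtered by the submodules $\bigoplus_{k=0}^n\mathrm{Symb}^k[h]$, $n\ge 0$. For all $a\in\mathrm{Symb}^n$, $b\in\mathrm{Symb}^m$, $$a\mathbin{\hat\star}b-a\cdot b\in h\bigoplus_{k=0}^{n+m-1}\mathrm{Symb}^k[h].$$ 2. For every $\hbar\in\Bbbk$, $(\mathrm{Symb}^\bullet,\star_\hbar)$ is a unital associative $\Bbbk$-algebra with unit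 $\mathrm{id}_E$, filtered by the submodules $\bigoplus_{k=0}^n\mathrm{Symb}^k$, which are the images under $\mathrm{ev}_\hbar$ of the submodules $\bigoplus_{k=0}^n\mathrm{Symb}^k[h]$. The map $\mathrm{ev}_\hbar$ induces an isomorphism of unital $\Bbbk$-algebras from the quotient of $(\mathrm{Symb}^\bullet[h],\hat\star)$ by the two-sided ideal generated by $h-\hbar$ onto $(\mathrm{Symb}^\bullet,\star_\hbar)$. For all $a\in\mathrm{Symb}^n$, $b\in\mathrm{Symb}^m$, $$a\star_\hbar b-a\cdot b\in\hbar\bigoplus_{k=0}^{n+m-1}\mathrm{Symb}^k.$$ (An empty direct sum is $0$.) -/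

import Mathlib

open scoped TensorProduct DirectSum Polynomial

universe u v w

noncomputable section

namespace NCJet

/-- An exterior algebra over the associative unital `k`-algebra `A`: a differential graded
`k`-algebra `Ω = ⨁ Ω^n` whose degree zero part is (a copy of) `A`, and which is generated as an
algebra by `A` and `dA`. -/
structure ExteriorCalculus (k : Type v) (A : Type u) (Ω : Type w) [CommRing k] [Ring A]
    [Algebra k A] [Ring Ω] [Algebra k Ω] where
  /-- the homogeneous components `Ω^n` -/
  grade : ℕ → Submodule k Ω
  isInternal : DirectSum.IsInternal grade
  mul_mem : ∀ {m n : ℕ} {α β : Ω}, α ∈ grade m → β ∈ grade n → α * β ∈ grade (m + n)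
  /-- the identification of `A` with `Ω^0` -/
  incl : A →ₐ[k] Ω
  incl_injective : Function.Injective incl
  range_incl : Subalgebra.toSubmodule incl.range = grade 0
  /-- the exterior derivative -/
  d : Ω →ₗ[k] Ω
  d_mem : ∀ {n : ℕ} {α : Ω}, α ∈ grade n → d α ∈ grade (n + 1)
  d_d : ∀ α : Ω, d (d α) = 0
  leibniz : ∀ {n : ℕ} {α : Ω}, α ∈ grade n →
    ∀ β : Ω, d (α * β) = d α * β + (-1) ^ n * (α * d β)
  generated : Algebra.adjoin k (Set.range incl ∪ Set.range fun a : A => d (incl a)) = ⊤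

section Calculus

variable {k : Type v} {A : Type u} {Ω : Type w} [CommRing k] [Ring A] [Algebra k A]
  [Ring Ω] [Algebra k Ω]

/-- A left `A`-module, together with its underlying `k`-module structure. -/
structure LMod (k : Type v) (A : Type u) [CommRing k] [Ring A] [Algebra k A] where
  carrier : Type u
  [grp : AddCommGroup carrier]
  [kmod : Module k carrier]
  [amod : Module A carrier]
  [tower : IsScalarTower k A carrier]

attribute [instance] LMod.grp LMod.kmod LMod.amod LMod.tower

/-- The `A`-linear map `A ⊗ E → P`, `a ⊗ x ↦ a • g x`, induced by a `k`-linear map `g : E → P`. -/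
def extend {E P : Type*} [AddCommGroup E] [Module k E] [AddCommGroup P] [Module k P] [Module A P]
    [IsScalarTower k A P] (g : E →ₗ[k] P) : A ⊗[k] E →ₗ[A] P :=
  TensorProduct.AlgebraTensorModule.lift (LinearMap.toSpanSingleton A (E →ₗ[k] P) g)

@[simp] theorem extend_tmul {E P : Type*} [AddCommGroup E] [Module k E] [AddCommGroup P]
    [Module k P] [Module A P] [IsScalarTower k A P] (g : E →ₗ[k] P) (a : A) (x : E) :
    extend g (a ⊗ₜ[k] x) = a • g x := rfl

/-- The map `A ⊗ A → A ⊗ E`, `a ⊗ b ↦ a ⊗ b x`. -/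
def rightAct {E : Type*} [AddCommGroup E] [Module k E] [Module A E] [IsScalarTower k A E]
    (x : E) : A ⊗[k] A →ₗ[A] A ⊗[k] E :=
  TensorProduct.AlgebraTensorModule.lTensor A A
    ((LinearMap.toSpanSingleton A E x).restrictScalars k)

@[simp] theorem rightAct_tmul {E : Type*} [AddCommGroup E] [Module k E] [Module A E]
    [IsScalarTower k A E] (x : E) (a b : A) :
    rightAct x (a ⊗ₜ[k] b) = a ⊗ₜ[k] (b • x) := rfl

namespace ExteriorCalculus

variable (X : ExteriorCalculus k A Ω)

theorem incl_mem (a : A) : X.incl a ∈ X.grade 0 := by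
  rw [← X.range_incl]; exact ⟨a, rfl⟩

/-- The `A`-bimodule `Ω^n` of forms of degree `n`. -/
def Form (n : ℕ) : Type w := X.grade n

instance (n : ℕ) : AddCommGroup (X.Form n) := inferInstanceAs (AddCommGroup (X.grade n))
instance (n : ℕ) : Module k (X.Form n) := inferInstanceAs (Module k (X.grade n))

instance (n : ℕ) : SMul A (X.Form n) where
  smul a α := ⟨X.incl a * α.1, by simpa using X.mul_mem (X.incl_mem a) α.2⟩

theorem Form.ext {n : ℕ} {α β : X.Form n} (h : α.1 = β.1) : α = β := Subtype.ext h

theorem smul_val {n : ℕ} (a : A) (α : X.Form n) : (a • α).1 = X.incl a * α.1 := rfl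
theorem add_val {n : ℕ} (α β : X.Form n) : (α + β).1 = α.1 + β.1 := rfl
theorem zero_val {n : ℕ} : (0 : X.Form n).1 = 0 := rfl
theorem ksmul_val {n : ℕ} (c : k) (α : X.Form n) : (c • α).1 = c • α.1 := rfl

instance (n : ℕ) : Module A (X.Form n) where
  one_smul α := Form.ext X (by simp [smul_val])
  mul_smul a b α := Form.ext X (by simp [smul_val, mul_assoc])
  smul_zero a := Form.ext X (by simp [smul_val, zero_val])
  smul_add a α β := Form.ext X (by simp [smul_val, add_val, mul_add])
  add_smul a b α := Form.ext X (by simp [smul_val, add_val, add_mul])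
  zero_smul α := Form.ext X (by simp [smul_val, zero_val])

instance (n : ℕ) : IsScalarTower k A (X.Form n) where
  smul_assoc c a α := Form.ext X (by simp [smul_val, ksmul_val])

/-- The right `A`-module structure of `Ω^n`. -/
def rmul {n : ℕ} (α : X.Form n) (a : A) : X.Form n :=
  ⟨α.1 * X.incl a, by simpa using X.mul_mem α.2 (X.incl_mem a)⟩

/-- The wedge product `da ∧ α` with the differential of `a`, for a `1`-form `α`. -/
def dWedge (a : A) (α : X.Form 1) : X.Form 2 :=
  ⟨X.d (X.incl a) * α.1, X.mul_mem (X.d_mem (X.incl_mem a)) α.2⟩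

/-- The differential `d : A → Ω^1`. -/
def dA : A →ₗ[k] X.Form 1 where
  toFun a := ⟨X.d (X.incl a), X.d_mem (X.incl_mem a)⟩
  map_add' a b := Form.ext X
    (show X.d (X.incl (a + b)) = X.d (X.incl a) + X.d (X.incl b) by simp)
  map_smul' c a := Form.ext X
    (show X.d (X.incl (c • a)) = c • X.d (X.incl a) by simp)

theorem dA_val (a : A) : (X.dA a).1 = X.d (X.incl a) := rfl

theorem d_incl_mul (a b : A) : X.d (X.incl (a * b)) =
    X.d (X.incl a) * X.incl b + X.incl a * X.d (X.incl b) := by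
  rw [map_mul, X.leibniz (X.incl_mem a)]; simp

/-- The kernel `N_d ⊆ A ⊗ A` of the projection onto the `1`-jets of `A`: the elements
`∑ aᵢ ⊗ bᵢ` with `∑ aᵢ bᵢ = 0` and `∑ aᵢ dbᵢ = 0`. -/
def relN : Submodule A (A ⊗[k] A) :=
  LinearMap.ker (extend (LinearMap.id : A →ₗ[k] A)) ⊓ LinearMap.ker (extend X.dA)

/-! ### The functor of 1-jets -/

section J1

variable (E : Type*) [AddCommGroup E] [Module k E] [Module A E] [IsScalarTower k A E]

/-- The image of `N_d ⊗ E` in `A ⊗ E` under `(a ⊗ b) ⊗ x ↦ a ⊗ b x`. -/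
def jetRel : Submodule A (A ⊗[k] E) := ⨆ x : E, X.relN.map (rightAct x)

/-- The module of `1`-jets `J^1 E = J^1 A ⊗_A E` with `J^1 A = (A ⊗ A) / N_d`, presented as
`(A ⊗ E) / N_d E`; the class of `a ⊗ (b x)` is `[a ⊗ b] ⊗_A x`. -/
def J1 : Type _ := (A ⊗[k] E) ⧸ X.jetRel E

instance : AddCommGroup (X.J1 E) := inferInstanceAs (AddCommGroup ((A ⊗[k] E) ⧸ X.jetRel E))
instance : Module A (X.J1 E) := inferInstanceAs (Module A ((A ⊗[k] E) ⧸ X.jetRel E))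
instance : Module k (X.J1 E) := inferInstanceAs (Module k ((A ⊗[k] E) ⧸ X.jetRel E))
instance : IsScalarTower k A (X.J1 E) :=
  inferInstanceAs (IsScalarTower k A ((A ⊗[k] E) ⧸ X.jetRel E))

variable {E}

/-- The projection `A ⊗ E → J^1 E`. -/
def J1.mk : A ⊗[k] E →ₗ[A] X.J1 E := (X.jetRel E).mkQ

theorem J1.hom_ext {P : Type*} [AddCommGroup P] [Module A P] {f g : X.J1 E →ₗ[A] P}
    (h : ∀ x : E, f (J1.mk X (1 ⊗ₜ x)) = g (J1.mk X (1 ⊗ₜ x))) : f = g := by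
  refine LinearMap.ext fun ξ => ?_
  obtain ⟨t, rfl⟩ := Submodule.mkQ_surjective _ ξ
  change f (J1.mk X t) = g (J1.mk X t)
  induction t with
  | zero => simp
  | add s t hs ht => simp only [map_add, hs, ht]
  | tmul a x =>
    have : (a ⊗ₜ[k] x : A ⊗[k] E) = a • ((1 : A) ⊗ₜ[k] x) := by
      rw [TensorProduct.smul_tmul', smul_eq_mul, mul_one]
    rw [this, map_smul, map_smul, map_smul, h]

/-- A `k`-linear map `g` whose extension to `A ⊗ E` kills the relations induces an `A`-linear
map on `1`-jets, `[a ⊗ x] ↦ a • g x`. -/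
def J1.lift {P : Type*} [AddCommGroup P] [Module k P] [Module A P] [IsScalarTower k A P]
    (g : E →ₗ[k] P)
    (hg : ∀ n ∈ X.relN, ∀ x : E, extend g (rightAct x n) = 0) : X.J1 E →ₗ[A] P :=
  (X.jetRel E).liftQ (extend g) (by
    refine iSup_le fun x => ?_
    rintro _ ⟨n, hn, rfl⟩
    exact hg n hn x)

@[simp] theorem J1.lift_mk {P : Type*} [AddCommGroup P] [Module k P] [Module A P]
    [IsScalarTower k A P] (g : E →ₗ[k] P)
    (hg : ∀ n ∈ X.relN, ∀ x : E, extend g (rightAct x n) = 0) (t : A ⊗[k] E) :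
    J1.lift X g hg (J1.mk X t) = extend g t := rfl

/-- The prolongation `j^1 : E → J^1 E`, `x ↦ [1 ⊗ x]`. -/
def j1 : E →ₗ[k] X.J1 E where
  toFun x := J1.mk X (1 ⊗ₜ x)
  map_add' x y := by rw [TensorProduct.tmul_add, map_add]
  map_smul' c x := by
    rw [TensorProduct.tmul_smul, RingHom.id_apply, ← algebraMap_smul A c, map_smul, algebraMap_smul]

theorem J1.mk_one_tmul (x : E) : J1.mk X (1 ⊗ₜ x) = X.j1 x := rfl

/-- The projection `π^{1,0} : J^1 E → E`, `[a ⊗ x] ↦ a x`. -/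
def pi10 : X.J1 E →ₗ[A] E :=
  J1.lift X LinearMap.id (by
    intro n hn x
    have h : (extend (LinearMap.id : E →ₗ[k] E)) ∘ₗ rightAct x =
        (LinearMap.toSpanSingleton A E x) ∘ₗ extend (LinearMap.id : A →ₗ[k] A) := by
      ext a; simp
    have := LinearMap.congr_fun h n
    simp only [LinearMap.comp_apply] at this
    rw [this, LinearMap.mem_ker.1 hn.1, map_zero])

theorem pi10_j1 (x : E) : X.pi10 (X.j1 x) = x := by
  change extend LinearMap.id ((1 : A) ⊗ₜ[k] x) = x
  simp

variable {F : Type*} [AddCommGroup F] [Module k F] [Module A F] [IsScalarTower k A F]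
  {G : Type*} [AddCommGroup G] [Module k G] [Module A G] [IsScalarTower k A G]

/-- The action of the functor `J^1` on an `A`-linear map: `[a ⊗ x] ↦ [a ⊗ f x]`. -/
def J1map (f : E →ₗ[A] F) : X.J1 E →ₗ[A] X.J1 F :=
  J1.lift X (X.j1 ∘ₗ f.restrictScalars k) (by
    intro n hn x
    have h : (extend (X.j1 ∘ₗ f.restrictScalars k)) ∘ₗ rightAct x =
        J1.mk X ∘ₗ rightAct (f x) := by
      ext a; simp [J1.mk_one_tmul]
    have := LinearMap.congr_fun h n
    simp only [LinearMap.comp_apply] at this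
    rw [this]
    exact (Submodule.Quotient.mk_eq_zero _).2
      (Submodule.mem_iSup_of_mem (f x) ⟨n, hn, rfl⟩))

@[simp] theorem J1map_j1 (f : E →ₗ[A] F) (x : E) : X.J1map f (X.j1 x) = X.j1 (f x) := by
  change extend (X.j1 ∘ₗ f.restrictScalars k) ((1 : A) ⊗ₜ[k] x) = _
  simp

theorem J1map_comp (g : F →ₗ[A] G) (f : E →ₗ[A] F) :
    X.J1map (g ∘ₗ f) = X.J1map g ∘ₗ X.J1map f :=
  J1.hom_ext X fun x => by simp [J1.mk_one_tmul]

end J1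

/-! ### The functor `Ω^1 ⋉ Ω^2` and the map cutting out holonomic jets -/

/-- The bimodule `Ω^1 ⋉ Ω^2`, with left action `a (α + β) = a α + da ∧ α + a β` and
componentwise right action. -/
def SemiForm : Type w := X.Form 1 × X.Form 2

instance : AddCommGroup X.SemiForm := inferInstanceAs (AddCommGroup (X.Form 1 × X.Form 2))
instance : Module k X.SemiForm := inferInstanceAs (Module k (X.Form 1 × X.Form 2))

instance : SMul A X.SemiForm where
  smul a s := (a • s.1, X.dWedge a s.1 + a • s.2)

theorem SemiForm.ext {s t : X.SemiForm} (h₁ : s.1.1 = t.1.1) (h₂ : s.2.1 = t.2.1) : s = t :=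
  Prod.ext (Subtype.ext h₁) (Subtype.ext h₂)

theorem SemiForm.smul_fst (a : A) (s : X.SemiForm) : (a • s).1.1 = X.incl a * s.1.1 := rfl
theorem SemiForm.smul_snd (a : A) (s : X.SemiForm) :
    (a • s).2.1 = X.d (X.incl a) * s.1.1 + X.incl a * s.2.1 := rfl
theorem SemiForm.add_fst (s t : X.SemiForm) : (s + t).1.1 = s.1.1 + t.1.1 := rfl
theorem SemiForm.add_snd (s t : X.SemiForm) : (s + t).2.1 = s.2.1 + t.2.1 := rfl
theorem SemiForm.zero_fst : (0 : X.SemiForm).1.1 = 0 := rfl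
theorem SemiForm.zero_snd : (0 : X.SemiForm).2.1 = 0 := rfl
theorem SemiForm.ksmul_fst (c : k) (s : X.SemiForm) : (c • s).1.1 = c • s.1.1 := rfl
theorem SemiForm.ksmul_snd (c : k) (s : X.SemiForm) : (c • s).2.1 = c • s.2.1 := rfl

theorem d_one : X.d 1 = 0 := by
  have := X.d_incl_mul 1 1
  simpa using this

instance : Module A X.SemiForm where
  one_smul s := SemiForm.ext X (by simp [SemiForm.smul_fst])
    (by simp [SemiForm.smul_snd, d_one])
  mul_smul a b s := SemiForm.ext X (by simp [SemiForm.smul_fst, mul_assoc])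
    (by
      simp only [SemiForm.smul_snd, SemiForm.smul_fst, d_incl_mul]
      rw [map_mul]; noncomm_ring)
  smul_zero a := SemiForm.ext X (by simp [SemiForm.smul_fst, SemiForm.zero_fst])
    (by simp [SemiForm.smul_snd, SemiForm.zero_fst, SemiForm.zero_snd])
  smul_add a s t := SemiForm.ext X
    (by simp [SemiForm.smul_fst, SemiForm.add_fst, mul_add])
    (by simp only [SemiForm.smul_snd, SemiForm.add_fst, SemiForm.add_snd]; noncomm_ring)
  add_smul a b s := SemiForm.ext X
    (by simp [SemiForm.smul_fst, SemiForm.add_fst, add_mul])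
    (by simp only [SemiForm.smul_snd, SemiForm.add_snd, map_add]; noncomm_ring)
  zero_smul s := SemiForm.ext X (by simp [SemiForm.smul_fst, SemiForm.zero_fst])
    (by simp [SemiForm.smul_snd, SemiForm.zero_snd])

instance : IsScalarTower k A X.SemiForm where
  smul_assoc c a s := SemiForm.ext X (by simp [SemiForm.smul_fst, SemiForm.ksmul_fst])
    (by simp [SemiForm.smul_snd, SemiForm.ksmul_snd])

/-- The componentwise right action on `Ω^1 ⋉ Ω^2`. -/
def SemiForm.rmul (s : X.SemiForm) (a : A) : X.SemiForm := (X.rmul s.1 a, X.rmul s.2 a)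

section Semi

set_option linter.unusedSectionVars false

variable (E : Type*) [AddCommGroup E] [Module k E] [Module A E] [IsScalarTower k A E]

/-- The relations `s a ⊗ x = s ⊗ a x` of the tensor product over `A`. -/
def semiRel : Submodule A (X.SemiForm ⊗[k] E) :=
  Submodule.span A {t | ∃ (s : X.SemiForm) (a : A) (x : E),
    t = SemiForm.rmul X s a ⊗ₜ[k] x - s ⊗ₜ[k] (a • x)}

/-- The left `A`-module `(Ω^1 ⋉ Ω^2)(E) = (Ω^1 ⋉ Ω^2) ⊗_A E`. -/
def Semi : Type _ := (X.SemiForm ⊗[k] E) ⧸ X.semiRel E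

instance : AddCommGroup (X.Semi E) :=
  inferInstanceAs (AddCommGroup ((X.SemiForm ⊗[k] E) ⧸ X.semiRel E))
instance : Module A (X.Semi E) :=
  inferInstanceAs (Module A ((X.SemiForm ⊗[k] E) ⧸ X.semiRel E))
instance : Module k (X.Semi E) :=
  inferInstanceAs (Module k ((X.SemiForm ⊗[k] E) ⧸ X.semiRel E))
instance : IsScalarTower k A (X.Semi E) :=
  inferInstanceAs (IsScalarTower k A ((X.SemiForm ⊗[k] E) ⧸ X.semiRel E))

variable {E}

/-- The class `s ⊗_A x` in `(Ω^1 ⋉ Ω^2)(E)`. -/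
def Semi.tmul (s : X.SemiForm) (x : E) : X.Semi E := (X.semiRel E).mkQ (s ⊗ₜ[k] x)

theorem Semi.rmul_tmul (s : X.SemiForm) (a : A) (x : E) :
    Semi.tmul X (SemiForm.rmul X s a) x = Semi.tmul X s (a • x) := by
  rw [← sub_eq_zero]
  exact (Submodule.Quotient.mk_eq_zero _).2 (Submodule.subset_span ⟨s, a, x, rfl⟩)

theorem Semi.smul_tmul (a : A) (s : X.SemiForm) (x : E) :
    a • Semi.tmul X s x = Semi.tmul X (a • s) x := rfl

/-- `s ⊗_A x` as an `A`-linear map in `s`. -/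
def Semi.tmulₗ (x : E) : X.SemiForm →ₗ[A] X.Semi E where
  toFun s := Semi.tmul X s x
  map_add' s t := by
    simp only [Semi.tmul]; rw [TensorProduct.add_tmul, map_add]; rfl
  map_smul' a s := rfl

variable {F : Type*} [AddCommGroup F] [Module k F] [Module A F] [IsScalarTower k A F]

/-- The action of the functor `Ω^1 ⋉ Ω^2` on an `A`-linear map. -/
def semiMap (f : E →ₗ[A] F) : X.Semi E →ₗ[A] X.Semi F :=
  (X.semiRel E).mapQ (X.semiRel F)
    (TensorProduct.AlgebraTensorModule.lTensor A X.SemiForm (f.restrictScalars k)) (by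
      refine Submodule.span_le.2 ?_
      rintro _ ⟨s, a, x, rfl⟩
      refine Submodule.subset_span ⟨s, a, f x, ?_⟩
      simp)

theorem semiMap_tmul (f : E →ₗ[A] F) (s : X.SemiForm) (x : E) :
    X.semiMap f (Semi.tmul X s x) = Semi.tmul X s (f x) := rfl

/-- The inclusion of `1`-forms in `Ω^1 ⋉ Ω^2`. -/
def embOne : X.Form 1 →ₗ[k] X.SemiForm := LinearMap.inl k (X.Form 1) (X.Form 2)

/-- The `1`-form `da`, seen in `Ω^1 ⋉ Ω^2`. -/
def dSemi : A →ₗ[k] X.SemiForm := embOne X ∘ₗ X.dA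

theorem dSemi_fst (a : A) : (X.dSemi a).1.1 = X.d (X.incl a) := rfl
theorem dSemi_snd (a : A) : (X.dSemi a).2.1 = 0 := rfl

/-- The `k`-linear map `A ⊗ E → (Ω^1 ⋉ Ω^2)(E)`, `c ⊗ x ↦ dc ⊗ x`. -/
def spencerAux : A ⊗[k] E →ₗ[k] X.Semi E :=
  ((X.semiRel E).mkQ.restrictScalars k) ∘ₗ TensorProduct.map X.dSemi LinearMap.id

theorem spencerAux_tmul (c : A) (x : E) :
    spencerAux X (c ⊗ₜ[k] x) = Semi.tmul X (X.dSemi c) x := rfl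

theorem extend_dSemi_fst (n : A ⊗[k] A) (c : A) :
    (extend (X.dSemi ∘ₗ (LinearMap.mulRight k c)) n).1.1 =
      (extend X.dA n).1 * X.incl c + X.incl (extend (LinearMap.id : A →ₗ[k] A) n) *
          X.d (X.incl c) := by
  induction n with
  | zero =>
    rw [map_zero, map_zero, map_zero, SemiForm.zero_fst, zero_val]; simp
  | add s t hs ht =>
    rw [map_add, map_add, map_add, SemiForm.add_fst, add_val, hs, ht, map_add]
    noncomm_ring
  | tmul a b =>
    rw [extend_tmul, SemiForm.smul_fst, extend_tmul, smul_val, extend_tmul, dA_val,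
      LinearMap.comp_apply, dSemi_fst, LinearMap.mulRight_apply, d_incl_mul, LinearMap.id_apply,
      smul_eq_mul, map_mul]
    noncomm_ring

theorem extend_dSemi_snd (n : A ⊗[k] A) (c : A) :
    (extend (X.dSemi ∘ₗ (LinearMap.mulRight k c)) n).2.1 =
      X.d (extend X.dA n).1 * X.incl c +
          (X.d (X.incl (extend (LinearMap.id : A →ₗ[k] A) n)) - (extend X.dA n).1) *
          X.d (X.incl c) := by
  induction n with
  | zero =>
    rw [map_zero, map_zero, map_zero, SemiForm.zero_snd, zero_val]; simp
  | add s t hs ht =>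
    rw [map_add, map_add, map_add, SemiForm.add_snd, add_val, hs, ht, map_add, map_add, map_add]
    noncomm_ring
  | tmul a b =>
    rw [extend_tmul, SemiForm.smul_snd, extend_tmul, smul_val, extend_tmul, dA_val,
      LinearMap.comp_apply, dSemi_fst, dSemi_snd, LinearMap.mulRight_apply, LinearMap.id_apply,
      smul_eq_mul, X.leibniz (X.incl_mem a), d_incl_mul, d_incl_mul, X.d_d]
    noncomm_ring

theorem extend_dSemi_eq_zero (n : A ⊗[k] A) (hn : n ∈ X.relN) (c : A) :
    extend (X.dSemi ∘ₗ (LinearMap.mulRight k c)) n = 0 := by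
  have h1 := LinearMap.mem_ker.1 hn.1
  have h2 := LinearMap.mem_ker.1 hn.2
  refine SemiForm.ext X ?_ ?_
  · rw [extend_dSemi_fst, h1, h2, zero_val, SemiForm.zero_fst]; simp
  · rw [extend_dSemi_snd, h1, h2, zero_val, SemiForm.zero_snd]; simp

theorem spencerAux_rightAct (x : E) (n : A ⊗[k] A) :
    spencerAux X (rightAct x n) = Semi.tmulₗ X x
      (X.dSemi (extend (LinearMap.id : A →ₗ[k] A) n) - embOne X (extend X.dA n)) := by
  induction n with
  | zero => simp
  | add s t hs ht =>
    rw [map_add, map_add, hs, ht, ← map_add]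
    congr 1
    simp only [map_add]
    abel
  | tmul a b =>
    rw [rightAct_tmul, spencerAux_tmul, ← Semi.rmul_tmul]
    refine congrArg (Semi.tmulₗ X x) (SemiForm.ext X ?_ ?_)
    · change X.d (X.incl a) * X.incl b = X.d (X.incl (a * b)) - X.incl a * X.d (X.incl b)
      rw [d_incl_mul]; simp
    · change 0 * X.incl b = 0 - 0
      simp

/-- The `k`-linear map `J^1 E → (Ω^1 ⋉ Ω^2)(E)`, `[a ⊗ b] ⊗ x ↦ (da) b ⊗ x`. -/
def spencer : X.J1 E →ₗ[k] X.Semi E :=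
  ((X.jetRel E).restrictScalars k).liftQ (spencerAux X) (by
    intro t ht
    rw [Submodule.restrictScalars_mem, jetRel] at ht
    rw [LinearMap.mem_ker]
    induction ht using Submodule.iSup_induction' with
    | mem x t ht =>
      obtain ⟨n, hn, rfl⟩ := ht
      have h1 := LinearMap.mem_ker.1 hn.1
      have h2 := LinearMap.mem_ker.1 hn.2
      rw [spencerAux_rightAct, h1, h2]
      simp
    | zero => simp
    | add s t _ _ hs ht => rw [map_add, hs, ht, add_zero])

theorem spencer_mk_tmul (c : A) (x : E) :
    X.spencer (J1.mk X (c ⊗ₜ x)) = Semi.tmul X (X.dSemi c) x := rfl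

theorem spencer_j1 (x : E) : X.spencer (X.j1 x) = 0 := by
  rw [← J1.mk_one_tmul, spencer_mk_tmul]
  refine Eq.trans ?_ (map_zero (Semi.tmulₗ X x))
  refine congrArg (Semi.tmulₗ X x) (SemiForm.ext X ?_ rfl)
  change X.d (X.incl 1) = 0
  rw [map_one, d_one]

/-- The `A`-linear map `D : J^1 J^1 E → (Ω^1 ⋉ Ω^2)(E)`,
`[a ⊗ b] ⊗ [c ⊗ x] ↦ (a d(bc) + da ∧ d(bc)) ⊗ x`. -/
def holD : X.J1 (X.J1 E) →ₗ[A] X.Semi E :=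
  J1.lift X X.spencer (by
    intro n hn ξ
    obtain ⟨t, rfl⟩ := Submodule.mkQ_surjective _ ξ
    change extend X.spencer (rightAct (J1.mk X t) n) = 0
    induction t with
    | zero =>
      have : (rightAct (J1.mk X (0 : A ⊗[k] E)) : A ⊗[k] A →ₗ[A] _) = 0 := by
        ext a; simp
      rw [this]; simp
    | add s t hs ht =>
      have : (rightAct (J1.mk X (s + t)) : A ⊗[k] A →ₗ[A] _) =
          rightAct (J1.mk X s) + rightAct (J1.mk X t) := by
        ext a; simp [TensorProduct.tmul_add]
      rw [this, LinearMap.add_apply, map_add, hs, ht, add_zero]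
    | tmul c x =>
      have h : (extend X.spencer) ∘ₗ rightAct (J1.mk X (c ⊗ₜ[k] x)) =
          Semi.tmulₗ X x ∘ₗ extend (X.dSemi ∘ₗ (LinearMap.mulRight k c)) := by
        ext b
        simp only [TensorProduct.AlgebraTensorModule.curry_apply, TensorProduct.curry_apply,
          LinearMap.coe_restrictScalars, LinearMap.comp_apply,
          rightAct_tmul, extend_tmul, one_smul]
        rw [← map_smul, TensorProduct.smul_tmul', smul_eq_mul, spencer_mk_tmul]
        rfl
      have := LinearMap.congr_fun h n
      simp only [LinearMap.comp_apply] at this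
      rw [this, extend_dSemi_eq_zero X n hn, map_zero])

theorem holD_j1 (ξ : X.J1 E) : X.holD (X.j1 ξ) = X.spencer ξ := by
  change extend X.spencer ((1 : A) ⊗ₜ[k] ξ) = _
  simp

theorem spencer_natural (f : E →ₗ[A] F) (ξ : X.J1 E) :
    X.spencer (X.J1map f ξ) = X.semiMap f (X.spencer ξ) := by
  obtain ⟨t, rfl⟩ := Submodule.mkQ_surjective _ ξ
  change X.spencer (X.J1map f (J1.mk X t)) = X.semiMap f (X.spencer (J1.mk X t))
  induction t with
  | zero => simp
  | add s t hs ht => simp only [map_add, hs, ht]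
  | tmul c x =>
    have : X.J1map f (J1.mk X (c ⊗ₜ x)) = J1.mk X (c ⊗ₜ f x) := by
      change extend (X.j1 ∘ₗ f.restrictScalars k) (c ⊗ₜ[k] x) = _
      rw [extend_tmul, LinearMap.comp_apply, ← J1.mk_one_tmul, ← map_smul,
        TensorProduct.smul_tmul', smul_eq_mul, mul_one]
      rfl
    rw [this]
    rfl

theorem holD_natural (f : E →ₗ[A] F) :
    X.holD ∘ₗ X.J1map (X.J1map f) = X.semiMap f ∘ₗ X.holD :=
  J1.hom_ext X fun ξ => by
    simp only [LinearMap.comp_apply, J1.mk_one_tmul, J1map_j1, holD_j1, spencer_natural]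

end Semi

/-! ### Holonomic jets and differential operators -/

section Jets

variable (E : Type u) [AddCommGroup E] [Module k E] [Module A E] [IsScalarTower k A E]
  (F : Type u) [AddCommGroup F] [Module k F] [Module A F] [IsScalarTower k A F]
  (G : Type u) [AddCommGroup G] [Module k G] [Module A G] [IsScalarTower k A G]

/-- Two consecutive jet modules `P = J^n E` and `Q = J^(n+1) E`, with the map `l : Q → J^1 P`
and the prolongations from `E`. -/
structure JetStage where
  P : LMod.{u} k A
  Q : LMod.{u} k A
  l : Q.carrier →ₗ[A] X.J1 P.carrier
  jP : E →ₗ[k] P.carrier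
  jQ : E →ₗ[k] Q.carrier
  comm : ∀ e, l (jQ e) = X.j1 (jP e)

/-- The first stage: `J^0 E = E` and `J^1 E`. -/
def jetStageZero : JetStage X E where
  P := ⟨E⟩
  Q := ⟨X.J1 E⟩
  l := LinearMap.id
  jP := LinearMap.id
  jQ := X.j1
  comm _ := rfl

variable {E} in
/-- The kernel of `J^1 J^(n+1) E → J^1 J^1 J^n E → (Ω^1 ⋉ Ω^2)(J^n E)`. -/
def JetStage.hol (S : JetStage X E) : Submodule A (X.J1 S.Q.carrier) :=
  LinearMap.ker (X.holD ∘ₗ X.J1map S.l)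

variable {E} in
/-- From `J^n E`, `J^(n+1) E` to `J^(n+1) E`, `J^(n+2) E`. -/
def JetStage.next (S : JetStage X E) : JetStage X E where
  P := S.Q
  Q := ⟨JetStage.hol X S⟩
  l := (JetStage.hol X S).subtype
  jP := S.jQ
  jQ := LinearMap.codRestrict ((JetStage.hol X S).restrictScalars k) (X.j1 ∘ₗ S.jQ) (fun e => by
    rw [Submodule.restrictScalars_mem, JetStage.hol, LinearMap.mem_ker]
    simp only [LinearMap.comp_apply, J1map_j1, S.comm, holD_j1, spencer_j1])
  comm _ := rfl

/-- The tower of holonomic jet modules of `E`. -/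
def jetStage : ℕ → JetStage X E
  | 0 => jetStageZero X E
  | n + 1 => JetStage.next X (jetStage n)

/-- The holonomic `n`-jets `J^n E`: `J^0 E = E`, `J^1 E` the `1`-jets, and `J^(n+2) E` the kernel
of `J^1 J^(n+1) E → J^1 J^1 J^n E → (Ω^1 ⋉ Ω^2)(J^n E)`. -/
abbrev Jet (n : ℕ) : Type u := (jetStage X E n).P.carrier

/-- The map `l^(n+1) : J^(n+1) E → J^1 J^n E`. -/
def jetL (n : ℕ) : X.Jet E (n + 1) →ₗ[A] X.J1 (X.Jet E n) := (jetStage X E n).l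

/-- The `n`-jet prolongation `j^n : E → J^n E`. -/
def jetJ (n : ℕ) : E →ₗ[k] X.Jet E n := (jetStage X E n).jP

/-- The jet projection `π^(n+1,n) : J^(n+1) E → J^n E`. -/
def jetPi (n : ℕ) : X.Jet E (n + 1) →ₗ[A] X.Jet E n := X.pi10 ∘ₗ X.jetL E n

variable {E} in
theorem jetL_jetJ (n : ℕ) (e : E) : X.jetL E n (X.jetJ E (n + 1) e) = X.j1 (X.jetJ E n e) :=
  (jetStage X E n).comm e

variable {E} in
theorem jetPi_jetJ (n : ℕ) (e : E) : X.jetPi E n (X.jetJ E (n + 1) e) = X.jetJ E n e := by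
  rw [jetPi, LinearMap.comp_apply, jetL_jetJ, pi10_j1]

/-- The linear differential operators `E → F` of order at most `n`: the `k`-linear maps that
factor as an `A`-linear map after the prolongation `j^n`. They form a left module over
`Hom_A(F, F)` under composition, `φ • Δ = φ ∘ Δ`. -/
def diffOp (n : ℕ) : Submodule (Module.End A F) (E →ₗ[k] F) where
  carrier := {Δ | ∃ L : X.Jet E n →ₗ[A] F, ∀ e, Δ e = L (X.jetJ E n e)}
  zero_mem' := ⟨0, fun e => rfl⟩
  add_mem' := by
    rintro Δ Δ' ⟨L, hL⟩ ⟨L', hL'⟩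
    exact ⟨L + L', fun e => by simp [hL, hL']⟩
  smul_mem' := by
    rintro φ Δ ⟨L, hL⟩
    exact ⟨φ ∘ₗ L, fun e => congrArg φ (hL e)⟩

/-- The differential operators of order strictly less than `n`. -/
def diffOpLT : ℕ → Submodule (Module.End A F) (E →ₗ[k] F)
  | 0 => ⊥
  | n + 1 => X.diffOp E F n

theorem diffOp_succ (n : ℕ) : X.diffOp E F n ≤ X.diffOp E F (n + 1) := by
  rintro Δ ⟨L, hL⟩
  exact ⟨L ∘ₗ X.jetPi E n, fun e => by rw [LinearMap.comp_apply, jetPi_jetJ, hL]⟩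

theorem diffOp_mono : Monotone (X.diffOp E F) := monotone_nat_of_le_succ (X.diffOp_succ E F)

variable {E F G}

/-- An `A`-linear map `J^m E → F` prolongs to compatible maps `J^(m+n) E → J^n F`. -/
theorem exists_prolong (m : ℕ) (L : X.Jet E m →ₗ[A] F) (n : ℕ) :
    ∃ (p : X.Jet E (m + n) →ₗ[A] X.Jet F n) (p' : X.Jet E (m + n + 1) →ₗ[A] X.Jet F (n + 1)),
      X.jetL F n ∘ₗ p' = X.J1map p ∘ₗ X.jetL E (m + n) ∧
      (∀ e, p (X.jetJ E (m + n) e) = X.jetJ F n (L (X.jetJ E m e))) ∧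
      ∀ e, p' (X.jetJ E (m + n + 1) e) = X.jetJ F (n + 1) (L (X.jetJ E m e)) := by
  induction n with
  | zero =>
    refine ⟨L, X.J1map L ∘ₗ X.jetL E m, rfl, fun e => rfl, fun e => ?_⟩
    change X.J1map L (X.jetL E m (X.jetJ E (m + 1) e)) = _
    rw [jetL_jetJ, J1map_j1]
    rfl
  | succ n ih =>
    obtain ⟨p, p', h, hp, hp'⟩ := ih
    have key : ∀ ξ : X.Jet E (m + n + 2),
        X.J1map p' (X.jetL E (m + n + 1) ξ) ∈ JetStage.hol X (jetStage X F n) := by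
      intro ξ
      have hξ : X.holD (X.J1map (X.jetL E (m + n)) (X.jetL E (m + n + 1) ξ)) = 0 :=
        LinearMap.mem_ker.1 ξ.2
      change X.holD (X.J1map (X.jetL F n) (X.J1map p' (X.jetL E (m + n + 1) ξ))) = 0
      rw [← LinearMap.comp_apply (X.J1map (X.jetL F n)), ← J1map_comp, h, J1map_comp,
        LinearMap.comp_apply, ← LinearMap.comp_apply X.holD, holD_natural, LinearMap.comp_apply,
        hξ, map_zero]
    let p'' : X.Jet E (m + n + 2) →ₗ[A] X.Jet F (n + 2) :=
      LinearMap.codRestrict (JetStage.hol X (jetStage X F n))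
        (X.J1map p' ∘ₗ X.jetL E (m + n + 1)) key
    refine ⟨p', p'', rfl, hp', fun e => Subtype.ext ?_⟩
    change X.J1map p' (X.jetL E (m + n + 1) (X.jetJ E (m + n + 2) e)) =
      X.jetL F (n + 1) (X.jetJ F (n + 2) (L (X.jetJ E m e)))
    rw [jetL_jetJ, jetL_jetJ, J1map_j1, hp']

/-- The composition of differential operators of orders at most `n` and `m` is one of order at
most `n + m`. -/
theorem comp_mem_diffOp {n m : ℕ} {Δ : F →ₗ[k] G} {Δ' : E →ₗ[k] F} (h : Δ ∈ X.diffOp F G n)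
    (h' : Δ' ∈ X.diffOp E F m) : Δ ∘ₗ Δ' ∈ X.diffOp E G (n + m) := by
  obtain ⟨L, hL⟩ := h
  obtain ⟨L', hL'⟩ := h'
  obtain ⟨p, -, -, hp, -⟩ := X.exists_prolong m L' n
  rw [add_comm]
  exact ⟨L ∘ₗ p, fun e => by
    rw [LinearMap.comp_apply, LinearMap.comp_apply, hp, hL, hL']⟩

theorem comp_mem_diffOpLT_left {n m : ℕ} {Δ : F →ₗ[k] G} {Δ' : E →ₗ[k] F}
    (h : Δ ∈ X.diffOpLT F G n) (h' : Δ' ∈ X.diffOp E F m) :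
    Δ ∘ₗ Δ' ∈ X.diffOpLT E G (n + m) := by
  cases n with
  | zero =>
    have : Δ = 0 := h
    rw [this, LinearMap.zero_comp]
    exact zero_mem _
  | succ n =>
    rw [Nat.succ_add]
    exact X.comp_mem_diffOp h h'

theorem comp_mem_diffOpLT_right {n m : ℕ} {Δ : F →ₗ[k] G} {Δ' : E →ₗ[k] F}
    (h : Δ ∈ X.diffOp F G n) (h' : Δ' ∈ X.diffOpLT E F m) :
    Δ ∘ₗ Δ' ∈ X.diffOpLT E G (n + m) := by
  cases m with
  | zero =>
    have : Δ' = 0 := h'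
    rw [this, LinearMap.comp_zero]
    exact zero_mem _
  | succ m => exact X.comp_mem_diffOp h h'

theorem id_mem_diffOp : (LinearMap.id : E →ₗ[k] E) ∈ X.diffOp E E 0 :=
  ⟨LinearMap.id, fun _ => rfl⟩

variable (E F)

/-- The symbols of order `n`: `Symb^n(E, F) = Diff^n(E, F) / Diff^(n-1)(E, F)`. -/
def Symb (n : ℕ) : Type _ :=
  X.diffOp E F n ⧸ (X.diffOpLT E F n).submoduleOf (X.diffOp E F n)

instance (n : ℕ) : AddCommGroup (X.Symb E F n) := inferInstanceAs (AddCommGroup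
  (X.diffOp E F n ⧸ (X.diffOpLT E F n).submoduleOf (X.diffOp E F n)))
instance (n : ℕ) : Module (Module.End A F) (X.Symb E F n) :=
  inferInstanceAs (Module (Module.End A F)
    (X.diffOp E F n ⧸ (X.diffOpLT E F n).submoduleOf (X.diffOp E F n)))
instance (n : ℕ) : Module k (X.Symb E F n) := inferInstanceAs (Module k
  (X.diffOp E F n ⧸ (X.diffOpLT E F n).submoduleOf (X.diffOp E F n)))
instance (n : ℕ) : IsScalarTower k (Module.End A F) (X.Symb E F n) :=
  inferInstanceAs (IsScalarTower k (Module.End A F)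
    (X.diffOp E F n ⧸ (X.diffOpLT E F n).submoduleOf (X.diffOp E F n)))

variable {E F}

/-- The symbol map `Diff^n(E, F) → Symb^n(E, F)`. -/
def symbol (n : ℕ) : X.diffOp E F n →ₗ[Module.End A F] X.Symb E F n :=
  ((X.diffOpLT E F n).submoduleOf (X.diffOp E F n)).mkQ

theorem symbol_eq_zero {n : ℕ} (Δ : X.diffOp E F n) :
    X.symbol n Δ = 0 ↔ Δ.1 ∈ X.diffOpLT E F n :=
  Submodule.Quotient.mk_eq_zero _

variable (E F) in
/-- A full quantization for `(E, F)`: a family of `Hom_A(F, F)`-linear right splittings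
`q^n : Symb^n(E, F) → Diff^n(E, F)` of the symbol maps. -/
structure FullQuantization where
  q : ∀ n : ℕ, X.Symb E F n →ₗ[Module.End A F] X.diffOp E F n
  symbol_q : ∀ (n : ℕ) (σ : X.Symb E F n), X.symbol n (q n σ) = σ

/-- The composition `Diff^n(F, G) × Diff^m(E, F) → Diff^(n+m)(E, G)`. -/
def diffComp (n m : ℕ) : X.diffOp F G n →ₗ[k] X.diffOp E F m →ₗ[k] X.diffOp E G (n + m) :=
  LinearMap.mk₂ k (fun Δ Δ' => ⟨Δ.1 ∘ₗ Δ'.1, X.comp_mem_diffOp Δ.2 Δ'.2⟩)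
    (fun _ _ _ => Subtype.ext (LinearMap.add_comp _ _ _))
    (fun _ _ _ => Subtype.ext (LinearMap.smul_comp _ _ _))
    (fun _ _ _ => Subtype.ext (LinearMap.comp_add _ _ _))
    (fun _ _ _ => Subtype.ext (LinearMap.comp_smul _ _ _))

theorem diffComp_val {n m : ℕ} (Δ : X.diffOp F G n) (Δ' : X.diffOp E F m) :
    (X.diffComp n m Δ Δ').1 = Δ.1 ∘ₗ Δ'.1 := rfl

/-- The product of symbols, `Symb^n(F, G) × Symb^m(E, F) → Symb^(n+m)(E, G)`: the product of the
symbols of two operators is the symbol of their composition. -/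
def symbMul {n m : ℕ} (a : X.Symb F G n) (b : X.Symb E F m) : X.Symb E G (n + m) :=
  Quotient.liftOn₂' a b (fun Δ Δ' => X.symbol (n + m) (X.diffComp n m Δ Δ')) (by
    intro Δ₁ Δ₁' Δ₂ Δ₂' h h'
    have h := (Submodule.quotientRel_def _).1 h
    have h' := (Submodule.quotientRel_def _).1 h'
    rw [← sub_eq_zero, ← map_sub, symbol_eq_zero]
    have : X.diffComp n m Δ₁ Δ₁' - X.diffComp n m Δ₂ Δ₂' =
        X.diffComp n m (Δ₁ - Δ₂) Δ₁' + X.diffComp n m Δ₂ (Δ₁' - Δ₂') := by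
      rw [map_sub, LinearMap.sub_apply, map_sub]; abel
    rw [this]
    exact add_mem (X.comp_mem_diffOpLT_left h Δ₁'.2) (X.comp_mem_diffOpLT_right Δ₂.2 h'))

theorem symbMul_symbol {n m : ℕ} (Δ : X.diffOp F G n) (Δ' : X.diffOp E F m) :
    X.symbMul (X.symbol n Δ) (X.symbol m Δ') = X.symbol (n + m) (X.diffComp n m Δ Δ') := rfl

namespace FullQuantization

variable {X} (Q : X.FullQuantization E F)

/-- One step of truncation: `Δ ↦ Δ - q^(n+1)(symbol of Δ)`, from order at most `n + 1` to order
at most `n`. -/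
def truncStep (n : ℕ) : X.diffOp E F (n + 1) →ₗ[Module.End A F] X.diffOp E F n :=
  LinearMap.codRestrict (X.diffOp E F n)
    ((X.diffOp E F (n + 1)).subtype ∘ₗ (LinearMap.id - Q.q (n + 1) ∘ₗ X.symbol (n + 1)))
    (fun Δ => by
      have h : X.symbol (n + 1) (Δ - Q.q (n + 1) (X.symbol (n + 1) Δ)) = 0 := by
        rw [map_sub, Q.symbol_q, sub_self]
      exact (X.symbol_eq_zero _).1 h)

/-- The `j`-truncation of an operator of order at most `n`: the operator itself if `n ≤ j`, and
otherwise obtained by successive truncation steps from order `n` down to order `j`. -/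
def trunc : ∀ n j : ℕ, X.diffOp E F n →ₗ[Module.End A F] X.diffOp E F j
  | 0, j => Submodule.inclusion (X.diffOp_mono E F (Nat.zero_le j))
  | n + 1, j =>
    if h : n + 1 ≤ j then Submodule.inclusion (X.diffOp_mono E F h)
    else trunc n j ∘ₗ Q.truncStep n

/-- The `j`-component of the total symbol: the `j`-symbol of the `j`-truncation of an operator of
order at most `n`. -/
def component (n j : ℕ) : X.diffOp E F n →ₗ[Module.End A F] X.Symb E F j :=
  X.symbol j ∘ₗ Q.trunc n j

end FullQuantization

variable (E) in
/-- The symbol module `Symb(E, E) = ⨁ Symb^n(E, E)`. -/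
abbrev SymbAlg : Type _ := ⨁ n : ℕ, X.Symb E E n

/-- The inclusion of the homogeneous symbols of degree `n`. -/
def symbOf (n : ℕ) : X.Symb E E n →ₗ[k] X.SymbAlg E :=
  DirectSum.lof k ℕ (fun n => X.Symb E E n) n

variable (E) in
/-- The identity of `E`, as a symbol of degree zero. -/
def symbOne : X.SymbAlg E := X.symbOf 0 (X.symbol 0 ⟨LinearMap.id, X.id_mem_diffOp⟩)

variable (E) in
/-- The submodule `⨁_{i < N} Symb^i(E, E)`. -/
def symbLT (N : ℕ) : Submodule k (X.SymbAlg E) :=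
  ⨆ i : Fin N, LinearMap.range (X.symbOf (E := E) i)

variable (E) in
/-- The module of polynomials `Symb(E, E)[h]`, where `h` is the variable of `k[X]`. -/
abbrev SymbPoly : Type _ := k[X] ⊗[k] X.SymbAlg E

namespace FullQuantization

variable {X} (Q : X.FullQuantization E E)

/-- The product `Symb^n × Symb^m → Symb[h]`,
`a ⋆ b = ∑_{i=0}^{n+m} h^i [q^n(a) ∘ q^m(b)]^(n+m-i)`. -/
def starHom (n m : ℕ) : X.Symb E E n →ₗ[k] X.Symb E E m →ₗ[k] X.SymbPoly E :=
  ∑ i ∈ Finset.range (n + m + 1),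
    ((X.diffComp n m).compl₁₂ ((Q.q n).restrictScalars k) ((Q.q m).restrictScalars k)).compr₂
      ((TensorProduct.mk k k[X] (X.SymbAlg E) (Polynomial.X ^ i)) ∘ₗ X.symbOf (n + m - i) ∘ₗ
        (Q.component (n + m) (n + m - i)).restrictScalars k)

theorem starHom_apply (n m : ℕ) (a : X.Symb E E n) (b : X.Symb E E m) :
    Q.starHom n m a b = ∑ i ∈ Finset.range (n + m + 1), (Polynomial.X ^ i : k[X]) ⊗ₜ[k]
      X.symbOf (n + m - i) (Q.component (n + m) (n + m - i)
        (X.diffComp n m (Q.q n a) (Q.q m b))) := by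
  simp [starHom, LinearMap.sum_apply]

/-- The `k`-bilinear extension `Symb × Symb → Symb[h]`. -/
def star : X.SymbAlg E →ₗ[k] X.SymbAlg E →ₗ[k] X.SymbPoly E :=
  DirectSum.toModule k ℕ _ fun n =>
    (DirectSum.toModule k ℕ (X.Symb E E n →ₗ[k] X.SymbPoly E) fun m =>
      (Q.starHom n m).flip).flip

theorem star_symbOf (n m : ℕ) (a : X.Symb E E n) (b : X.Symb E E m) :
    Q.star (X.symbOf n a) (X.symbOf m b) = Q.starHom n m a b := by
  simp [star, symbOf]

/-- The formal star product: the `k[h]`-bilinear extension to `Symb[h]`. -/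
def formalStar : X.SymbPoly E →ₗ[k[X]] X.SymbPoly E →ₗ[k[X]] X.SymbPoly E :=
  LinearMap.liftBaseChange k[X]
    (((LinearMap.liftBaseChangeEquiv k[X] (M := X.SymbAlg E) (N := X.SymbPoly E)).restrictScalars
      k).toLinearMap ∘ₗ Q.star)

theorem formalStar_tmul (p r : k[X]) (s t : X.SymbAlg E) :
    Q.formalStar (p ⊗ₜ s) (r ⊗ₜ t) = (p * r) • Q.star s t := by
  simp [formalStar, mul_smul]

end FullQuantization

variable (E) in
/-- The evaluation `Symb[h] → Symb` at `h = ħ`. -/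
def evalAt (ħ : k) : X.SymbPoly E →ₗ[k] X.SymbAlg E :=
  TensorProduct.lift ((LinearMap.lsmul k (X.SymbAlg E)) ∘ₗ Polynomial.leval ħ)

theorem evalAt_tmul (ħ : k) (p : k[X]) (s : X.SymbAlg E) :
    X.evalAt E ħ (p ⊗ₜ s) = p.eval ħ • s := rfl

/-- The star product with parameter `ħ`: `a ⋆ b` evaluated at `h = ħ`. -/
def FullQuantization.starAt {X : ExteriorCalculus k A Ω} (Q : X.FullQuantization E E) (ħ : k) :
    X.SymbAlg E →ₗ[k] X.SymbAlg E →ₗ[k] X.SymbAlg E :=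
  Q.star.compr₂ (X.evalAt E ħ)

end Jets

end ExteriorCalculus

end Calculus

/-- `mul`, `one` make the `R`-module `M` into a unital associative algebra, filtered by the
increasing exhaustive family of submodules `F`. -/
structure IsFilteredAlgebra {R M : Type*} [CommRing R] [AddCommGroup M] [Module R M]
    (mul : M →ₗ[R] M →ₗ[R] M) (one : M) (F : ℕ → Submodule R M) : Prop where
  mul_assoc : ∀ a b c, mul (mul a b) c = mul a (mul b c)
  one_mul : ∀ a, mul one a = a
  mul_one : ∀ a, mul a one = a
  mono : Monotone F
  exhaustive : ∀ a, ∃ n, a ∈ F n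
  one_mem : one ∈ F 0
  mul_mem : ∀ {m n a b}, a ∈ F m → b ∈ F n → mul a b ∈ F (m + n)

/-- The two-sided ideal generated by an element, for a bilinear product on a module. -/
def twoSidedIdeal {R M : Type*} [CommRing R] [AddCommGroup M] [Module R M]
    (mul : M →ₗ[R] M →ₗ[R] M) (x : M) : Submodule R M :=
  sInf {I | x ∈ I ∧ ∀ a ∈ I, ∀ b, mul a b ∈ I ∧ mul b a ∈ I}

end NCJet

end

/-! The product on symbols is composition of operators seen through the quantization. Since `Δ` is
the sum of the `qʲ` of its components, `q(a) ∘ q(b)` is recovered from the coefficients of `a ⋆ b`.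
The powers of `h` record the drop in order, so sending `a ∈ Symbⁿ` to `hⁿ qⁿ(a)` turns the formal
product into composition in `End(E)[h]`, as in a Rees construction: the term with `hⁱ` has degree `n
+ m - i`, hence total weight `h^(n+m)` for every `i` (`formalQ_starHom`).

This map `formalQ` is multiplicative, preserves the unit and is injective. Injectivity has two
sources: the leading symbol of `∑ qⁿ(aₙ)` is its top `aₙ` (`totalQ_injective`), which survives base
change because `k[X]` is flat over `k`, and multiplication by `hⁿ` on `k[X]` is a split injection
(`rescale_injective`). Associativity and the unit laws are therefore pulled back from `End(E)[h]`.

For a value `ħ` the same map can fail to be injective, for instance at `ħ = 0`, so `⋆_ħ` is treated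
as a quotient: evaluation is a surjective homomorphism (`evalAt_formalStar`), and by the factor
theorem its kernel is generated by `h - ħ`. -/

noncomputable section

namespace NCJet

/-! ### Rescaling a graded module by powers of the polynomial variable -/

section Rescale

variable {k : Type*} [CommRing k] (M : ℕ → Type*) [∀ n, AddCommGroup (M n)]
  [∀ n, Module k (M n)]

/-- The `k[X]`-linear endomorphism of `M[X]` that multiplies the homogeneous elements of degree
`n` by `X ^ n`. -/
def rescale : k[X] ⊗[k] (⨁ n, M n) →ₗ[k[X]] k[X] ⊗[k] (⨁ n, M n) :=
  LinearMap.liftBaseChange k[X] (DirectSum.toModule k ℕ _ fun n =>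
    TensorProduct.mk k k[X] (⨁ n, M n) (Polynomial.X ^ n) ∘ₗ DirectSum.lof k ℕ M n)

theorem rescale_tmul_lof (p : k[X]) (n : ℕ) (a : M n) :
    rescale M (p ⊗ₜ[k] DirectSum.lof k ℕ M n a) =
      (p * Polynomial.X ^ n) ⊗ₜ[k] DirectSum.lof k ℕ M n a := by
  simp [rescale, TensorProduct.smul_tmul']

/-- Division of polynomials by the variable, as a linear map. -/
def divXLinear (k : Type*) [CommRing k] : k[X] →ₗ[k] k[X] where
  toFun := Polynomial.divX
  map_add' _ _ := Polynomial.divX_add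
  map_smul' c p := by
    rw [Polynomial.smul_eq_C_mul, Polynomial.divX_C_mul, RingHom.id_apply,
      Polynomial.smul_eq_C_mul]

theorem divXLinear_pow_mul_X_pow (n : ℕ) (p : k[X]) :
    (divXLinear k ^ n) (p * Polynomial.X ^ n) = p := by
  induction n with
  | zero => simp
  | succ n ih =>
    have h : divXLinear k (p * Polynomial.X ^ (n + 1)) = p * Polynomial.X ^ n :=
      Polynomial.ext fun i => by
        simp [divXLinear, Polynomial.coeff_divX, pow_succ, ← mul_assoc]
    rw [pow_succ, Module.End.mul_apply, h, ih]

/-- Dividing the degree `n` part by `Xⁿ` gives a left inverse. It is only `k`-linear, but this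
suffices and works for arbitrary modules `M n`. -/
theorem rescale_injective : Function.Injective (rescale (k := k) M) := by
  let g : k[X] ⊗[k] (⨁ n, M n) →ₗ[k] k[X] ⊗[k] (⨁ n, M n) :=
    TensorProduct.lift (DirectSum.toModule k ℕ (k[X] →ₗ[k] k[X] ⊗[k] (⨁ n, M n)) fun n =>
      ((TensorProduct.mk k k[X] (⨁ n, M n) ∘ₗ (divXLinear k ^ n)).compl₂
        (DirectSum.lof k ℕ M n)).flip).flip
  have h : g ∘ₗ (rescale (k := k) M).restrictScalars k = LinearMap.id := by
    refine TensorProduct.ext' fun p s => ?_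
    induction s using DirectSum.induction_on with
    | zero => simp
    | of n a =>
      rw [← DirectSum.lof_eq_of k, LinearMap.comp_apply, LinearMap.restrictScalars_apply,
        rescale_tmul_lof]
      simp [g, divXLinear_pow_mul_X_pow]
    | add s t hs ht => simp only [TensorProduct.tmul_add, map_add, hs, ht]
  exact Function.LeftInverse.injective (g := g) (LinearMap.congr_fun h)

end Rescale

namespace ExteriorCalculus

variable {k : Type v} {A : Type u} {Ω : Type w} [CommRing k] [Ring A] [Algebra k A]
  [Ring Ω] [Algebra k Ω] {X : ExteriorCalculus k A Ω}
  {E : Type u} [AddCommGroup E] [Module k E] [Module A E] [IsScalarTower k A E]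

/-! ### Reduction to homogeneous symbols -/

theorem symbAlg_induction {p : X.SymbAlg E → Prop} (zero : p 0)
    (symbOf : ∀ n (a : X.Symb E E n), p (X.symbOf n a))
    (add : ∀ s t, p s → p t → p (s + t)) (s : X.SymbAlg E) : p s := by
  induction s using DirectSum.induction_on with
  | zero => exact zero
  | of n a => exact symbOf n a
  | add s t hs ht => exact add s t hs ht

theorem symbPoly_induction {p : X.SymbPoly E → Prop} (zero : p 0)
    (tmul : ∀ (r : k[X]) n (a : X.Symb E E n), p (r ⊗ₜ X.symbOf n a))
    (add : ∀ s t, p s → p t → p (s + t)) (s : X.SymbPoly E) : p s := by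
  induction s using TensorProduct.induction_on with
  | zero => exact zero
  | add s t hs ht => exact add s t hs ht
  | tmul r s =>
    induction s using symbAlg_induction with
    | zero => rwa [TensorProduct.tmul_zero]
    | symbOf n a => exact tmul r n a
    | add s t hs ht => rw [TensorProduct.tmul_add]; exact add _ _ hs ht

namespace FullQuantization

/-! ### Truncations and components of operators -/

section Components

variable {F : Type u} [AddCommGroup F] [Module k F] [Module A F] [IsScalarTower k A F]
  (Q : X.FullQuantization E F)

/-- There are no nonzero operators of order below zero, so the symbol map in degree zero is
injective and `q⁰` is its two-sided inverse. -/
theorem q_symbol_zero (Δ : X.diffOp E F 0) : Q.q 0 (X.symbol 0 Δ) = Δ := by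
  rw [← sub_eq_zero]
  have h := (X.symbol_eq_zero (Q.q 0 (X.symbol 0 Δ) - Δ)).1
    (by rw [map_sub, Q.symbol_q, sub_self])
  exact Subtype.ext h

theorem trunc_self (n : ℕ) (Δ : X.diffOp E F n) : Q.trunc n n Δ = Δ := by
  cases n with
  | zero => rfl
  | succ n => rw [trunc, dif_pos le_rfl]; rfl

theorem component_self (n : ℕ) (Δ : X.diffOp E F n) : Q.component n n Δ = X.symbol n Δ := by
  rw [component, LinearMap.comp_apply, trunc_self]

theorem component_succ {n j : ℕ} (h : j ≤ n) (Δ : X.diffOp E F (n + 1)) :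
    Q.component (n + 1) j Δ = Q.component n j (Q.truncStep n Δ) := by
  rw [component, LinearMap.comp_apply, trunc, dif_neg (by omega)]
  rfl

theorem truncStep_val (n : ℕ) (Δ : X.diffOp E F (n + 1)) :
    (Q.truncStep n Δ).1 = Δ.1 - (Q.q (n + 1) (X.symbol (n + 1) Δ)).1 := rfl

/-- An operator is recovered by quantizing its total symbol. -/
theorem sum_q_component (n : ℕ) (Δ : X.diffOp E F n) :
    ∑ j ∈ Finset.range (n + 1), (Q.q j (Q.component n j Δ)).1 = Δ.1 := by
  induction n with
  | zero => rw [Finset.sum_range_one, component_self, q_symbol_zero]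
  -- The sum telescopes: its top term is exactly what `truncStep` subtracts, and the lower terms are
  -- the expansion of the truncated operator.
  | succ n ih =>
    rw [Finset.sum_range_succ, component_self, Finset.sum_congr rfl fun j hj => by
      rw [Q.component_succ (by simpa [Nat.lt_succ_iff] using hj)], ih, truncStep_val,
      sub_add_cancel]

end Components

variable (Q : X.FullQuantization E E)

/-! ### The total quantization -/

/-- The total quantization `Symb → End E`, `∑ aₙ ↦ ∑ qⁿ(aₙ)`. -/
def totalQ : X.SymbAlg E →ₗ[k] Module.End k E :=
  DirectSum.toModule k ℕ _ fun n =>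
    ((X.diffOp E E n).subtype ∘ₗ Q.q n).restrictScalars k

theorem totalQ_symbOf (n : ℕ) (a : X.Symb E E n) : Q.totalQ (X.symbOf n a) = (Q.q n a).1 := by
  simp [totalQ, symbOf]

theorem sum_q_mem_diffOpLT (s : X.SymbAlg E) (N : ℕ) :
    ∑ n ∈ Finset.range N, (Q.q n (s n)).1 ∈ X.diffOpLT E E N := by
  cases N with
  | zero => exact zero_mem _
  | succ N => exact sum_mem fun n hn =>
      X.diffOp_mono E E (by simpa [Nat.lt_succ_iff] using hn) (Q.q n (s n)).2

/-- Descent on the leading term: if the sum vanishes, the top `q^N(s N)` equals minus an operator of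
order below `N`, so its symbol `s N` is zero and the term can be dropped. -/
theorem eq_zero_of_sum_q_eq_zero (s : X.SymbAlg E) (N : ℕ)
    (h : ∑ n ∈ Finset.range N, (Q.q n (s n)).1 = 0) : ∀ n < N, s n = 0 := by
  induction N with
  | zero => simp
  | succ N ih =>
    have hN : s N = 0 := by
      rw [← Q.symbol_q N (s N), symbol_eq_zero]
      rw [Finset.sum_range_succ] at h
      rw [eq_neg_of_add_eq_zero_right h]
      exact neg_mem (Q.sum_q_mem_diffOpLT s N)
    rw [Finset.sum_range_succ, hN, map_zero, Submodule.coe_zero, add_zero] at h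
    intro n hn
    rcases Nat.lt_succ_iff_lt_or_eq.1 hn with hn | rfl
    exacts [ih h n hn, hN]

theorem totalQ_injective : Function.Injective Q.totalQ := by
  classical
  rw [injective_iff_map_eq_zero]
  intro s hs
  -- The descent needs a starting point, which the finite support of `s` provides.
  obtain ⟨N, hN⟩ : ∃ N, ∀ n, N ≤ n → s n = 0 := by
    refine ⟨(DFinsupp.support s).sup id + 1, fun n hn => ?_⟩
    by_contra h
    have := Finset.le_sup (f := id) (DFinsupp.mem_support_iff.2 h)
    simp only [id] at this
    omega
  have key : s = ∑ n ∈ Finset.range N, X.symbOf n (s n) := by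
    refine DFinsupp.ext fun n => ?_
    rw [DFinsupp.finsetSum_apply]
    by_cases hn : n < N
    · rw [Finset.sum_eq_single_of_mem n (Finset.mem_range.2 hn)]
      · exact (DirectSum.of_eq_same n _).symm
      · exact fun m _ hm => DirectSum.of_eq_of_ne _ _ _ hm.symm
    · rw [hN n (not_lt.1 hn), Finset.sum_eq_zero]
      intro m hm
      exact DirectSum.of_eq_of_ne _ _ _ (by rintro rfl; exact hn (Finset.mem_range.1 hm))
  have h := Q.eq_zero_of_sum_q_eq_zero s N (by
    rw [← hs]
    conv_rhs => rw [key]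
    simp only [map_sum, totalQ_symbOf])
  refine DFinsupp.ext fun n => ?_
  rcases lt_or_ge n N with hn | hn
  exacts [h n hn, hN n hn]

/-- The formal total quantization `Symb[h] → End(E)[h]`, sending `a ∈ Symbⁿ` to `hⁿ qⁿ(a)`. -/
def formalQ : X.SymbPoly E →ₗ[k[X]] k[X] ⊗[k] Module.End k E :=
  Q.totalQ.baseChange k[X] ∘ₗ rescale fun n => X.Symb E E n

theorem formalQ_tmul_symbOf (p : k[X]) (n : ℕ) (a : X.Symb E E n) :
    Q.formalQ (p ⊗ₜ[k] X.symbOf n a) = (p * Polynomial.X ^ n) ⊗ₜ[k] (Q.q n a).1 := by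
  rw [formalQ, LinearMap.comp_apply, symbOf, rescale_tmul_lof, LinearMap.baseChange_tmul]
  exact congrArg _ (Q.totalQ_symbOf n a)

/-- Flatness of `k[X]` carries injectivity of `totalQ` to polynomials; no assumption on the symbol
modules is needed. -/
theorem formalQ_injective : Function.Injective Q.formalQ :=
  (Module.Flat.lTensor_preserves_injective_linearMap (M := k[X]) _ Q.totalQ_injective).comp
    (rescale_injective _)

/-- The weight `hⁱ` in the star product compensates the weight `h^(n+m-i)` of a component of that
degree, so one common power factors out and the quantized components sum to the composition. -/
theorem formalQ_starHom (n m : ℕ) (a : X.Symb E E n) (b : X.Symb E E m) :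
    Q.formalQ (Q.starHom n m a b) =
      (Polynomial.X ^ (n + m)) ⊗ₜ[k] ((Q.q n a).1 ∘ₗ (Q.q m b).1) := by
  -- One sum is indexed by the power of `h`, the other by the degree of the component; the
  -- reflection `i ↦ n + m - i` matches them.
  rw [starHom_apply, map_sum, ← diffComp_val, ← Q.sum_q_component, TensorProduct.tmul_sum,
    ← Finset.sum_range_reflect]
  refine Finset.sum_congr rfl fun i hi => ?_
  have hi : i ≤ n + m := by simpa [Nat.lt_succ_iff] using hi
  rw [formalQ_tmul_symbOf, ← pow_add]
  have e : n + m + 1 - 1 - i = n + m - i := by omega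
  have e' : n + m - (n + m - i) = i := by omega
  rw [e, e', Nat.sub_add_cancel hi]

theorem formalQ_formalStar (x y : X.SymbPoly E) :
    Q.formalQ (Q.formalStar x y) = Q.formalQ x * Q.formalQ y := by
  induction x using symbPoly_induction with
  | zero => simp
  | add x x' hx hx' => simp only [map_add, LinearMap.add_apply, hx, hx', add_mul]
  | tmul p n a =>
    induction y using symbPoly_induction with
    | zero => simp
    | add y y' hy hy' => simp only [map_add, hy, hy', mul_add]
    | tmul r m b =>
      rw [formalStar_tmul, star_symbOf, map_smul, formalQ_starHom, formalQ_tmul_symbOf,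
        formalQ_tmul_symbOf, Algebra.TensorProduct.tmul_mul_tmul, TensorProduct.smul_tmul',
        smul_eq_mul, pow_add]
      congr 1
      ring

theorem formalQ_one : Q.formalQ (1 ⊗ₜ[k] X.symbOne E) = 1 := by
  rw [symbOne, formalQ_tmul_symbOf, q_symbol_zero, pow_zero, one_mul]; rfl

/-! ### Algebra laws pulled back along the injective multiplicative map -/

theorem formalStar_assoc (x y z : X.SymbPoly E) :
    Q.formalStar (Q.formalStar x y) z = Q.formalStar x (Q.formalStar y z) :=
  Q.formalQ_injective (by simp only [formalQ_formalStar, mul_assoc])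

theorem one_formalStar (x : X.SymbPoly E) : Q.formalStar (1 ⊗ₜ[k] X.symbOne E) x = x :=
  Q.formalQ_injective (by rw [formalQ_formalStar, formalQ_one, one_mul])

theorem formalStar_one (x : X.SymbPoly E) : Q.formalStar x (1 ⊗ₜ[k] X.symbOne E) = x :=
  Q.formalQ_injective (by rw [formalQ_formalStar, formalQ_one, mul_one])

end FullQuantization

/-! ### The filtration by the order of symbols -/

theorem symbOf_mem_symbLT {n N : ℕ} (h : n < N) (a : X.Symb E E n) :
    X.symbOf n a ∈ X.symbLT E N :=
  Submodule.mem_iSup_of_mem (⟨n, h⟩ : Fin N) ⟨a, rfl⟩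

theorem symbLT_le {N : ℕ} {P : Submodule k (X.SymbAlg E)}
    (h : ∀ n < N, ∀ a : X.Symb E E n, X.symbOf n a ∈ P) : X.symbLT E N ≤ P :=
  iSup_le fun i => by rintro _ ⟨a, rfl⟩; exact h i i.2 a

theorem symbLT_mono : Monotone (X.symbLT E) := fun _ _ h =>
  symbLT_le fun _ hn a => symbOf_mem_symbLT (hn.trans_le h) a

theorem symbLT_exhaustive (s : X.SymbAlg E) : ∃ n, s ∈ X.symbLT E (n + 1) := by
  induction s using symbAlg_induction with
  | zero => exact ⟨0, zero_mem _⟩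
  | symbOf n a => exact ⟨n, symbOf_mem_symbLT n.lt_succ_self a⟩
  | add s t hs ht =>
    obtain ⟨n, hn⟩ := hs
    obtain ⟨m, hm⟩ := ht
    exact ⟨max n m, add_mem (symbLT_mono (by omega) hn) (symbLT_mono (by omega) hm)⟩

theorem symbPoly_exhaustive (x : X.SymbPoly E) :
    ∃ n, x ∈ (X.symbLT E (n + 1)).baseChange k[X] := by
  induction x using TensorProduct.induction_on with
  | zero => exact ⟨0, zero_mem _⟩
  | tmul p s =>
    obtain ⟨n, hn⟩ := symbLT_exhaustive s
    exact ⟨n, Submodule.tmul_mem_baseChange_of_mem p hn⟩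
  | add x y hx hy =>
    obtain ⟨n, hn⟩ := hx
    obtain ⟨m, hm⟩ := hy
    exact ⟨max n m, add_mem (Submodule.baseChange_mono _ (symbLT_mono (by omega)) hn)
      (Submodule.baseChange_mono _ (symbLT_mono (by omega)) hm)⟩

theorem symbOne_mem : X.symbOne E ∈ X.symbLT E 1 := symbOf_mem_symbLT Nat.zero_lt_one _

namespace FullQuantization

variable (Q : X.FullQuantization E E)

/-! ### Compatibility of the product with the filtration -/

theorem starHom_mem (n m : ℕ) (a : X.Symb E E n) (b : X.Symb E E m) :
    Q.starHom n m a b ∈ (X.symbLT E (n + m + 1)).baseChange k[X] := by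
  rw [starHom_apply]
  exact sum_mem fun i _ =>
    Submodule.tmul_mem_baseChange_of_mem _ (symbOf_mem_symbLT (by omega) _)

theorem star_mem {n m : ℕ} {s t : X.SymbAlg E} (hs : s ∈ X.symbLT E (n + 1))
    (ht : t ∈ X.symbLT E (m + 1)) :
    Q.star s t ∈ (X.symbLT E (n + m + 1)).baseChange k[X] := by
  -- `star` is only `k`-bilinear, so the target is viewed over `k`; each argument is then reduced in
  -- turn to homogeneous symbols.
  let P := ((X.symbLT E (n + m + 1)).baseChange k[X]).restrictScalars k
  have h : X.symbLT E (n + 1) ≤ P.comap (Q.star.flip t) := by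
    refine symbLT_le fun i hi a => ?_
    have h' : X.symbLT E (m + 1) ≤ P.comap (Q.star (X.symbOf i a)) :=
      symbLT_le fun j hj b => by
        rw [Submodule.mem_comap, star_symbOf]
        exact Submodule.baseChange_mono _ (symbLT_mono (show i + j + 1 ≤ n + m + 1 by omega))
          (Q.starHom_mem i j a b)
    exact h' ht
  exact h hs

/-- The filtration steps are spanned over `k[X]` by constants `1 ⊗ s`, so bilinearity reduces the
claim to `star_mem`. -/
theorem formalStar_mem {n m : ℕ} {x y : X.SymbPoly E}
    (hx : x ∈ (X.symbLT E (n + 1)).baseChange k[X])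
    (hy : y ∈ (X.symbLT E (m + 1)).baseChange k[X]) :
    Q.formalStar x y ∈ (X.symbLT E (n + m + 1)).baseChange k[X] := by
  have h : (X.symbLT E (n + 1)).baseChange k[X] ≤
      ((X.symbLT E (n + m + 1)).baseChange k[X]).comap (Q.formalStar.flip y) := by
    rw [Submodule.baseChange_eq_span, Submodule.span_le]
    rintro _ ⟨s, hs, rfl⟩
    have h' : (X.symbLT E (m + 1)).baseChange k[X] ≤
        ((X.symbLT E (n + m + 1)).baseChange k[X]).comap (Q.formalStar (1 ⊗ₜ[k] s)) := by
      rw [Submodule.baseChange_eq_span, Submodule.span_le]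
      rintro _ ⟨t, ht, rfl⟩
      change Q.formalStar (1 ⊗ₜ[k] s) (1 ⊗ₜ[k] t) ∈ (X.symbLT E (n + m + 1)).baseChange k[X]
      rw [formalStar_tmul]
      exact Submodule.smul_mem _ _ (Q.star_mem hs ht)
    exact h' hy
  exact h hx

/-- The index is shifted because `symbLT` bounds degrees strictly: degrees at most `n` are those
below `n + 1`. -/
theorem isFilteredAlgebra_formalStar :
    IsFilteredAlgebra Q.formalStar (1 ⊗ₜ[k] X.symbOne E)
      (fun n => (X.symbLT E (n + 1)).baseChange k[X]) where
  mul_assoc := Q.formalStar_assoc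
  one_mul := Q.one_formalStar
  mul_one := Q.formalStar_one
  mono _ _ h := Submodule.baseChange_mono _ (symbLT_mono (Nat.succ_le_succ h))
  exhaustive := symbPoly_exhaustive
  one_mem := Submodule.tmul_mem_baseChange_of_mem 1 symbOne_mem
  mul_mem := Q.formalStar_mem

/-- The star product deforms the symbol product. -/
theorem exists_starHom_sub_symbMul (n m : ℕ) (a : X.Symb E E n) (b : X.Symb E E m) :
    ∃ r ∈ (X.symbLT E (n + m)).baseChange k[X],
      Q.starHom n m a b - 1 ⊗ₜ[k] X.symbOf (n + m) (X.symbMul a b) =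
        (Polynomial.X : k[X]) • r := by
  -- The remainder is the star product without its `i = 0` term, divided once by `h`; index `i` here
  -- stands for `i + 1` there, which makes the degrees strictly less than `n + m`.
  refine ⟨∑ i ∈ Finset.range (n + m), (Polynomial.X ^ i : k[X]) ⊗ₜ[k]
      X.symbOf (n + m - (i + 1)) (Q.component (n + m) (n + m - (i + 1))
        (X.diffComp n m (Q.q n a) (Q.q m b))), sum_mem fun i hi =>
    Submodule.tmul_mem_baseChange_of_mem _ (symbOf_mem_symbLT
      (by have := Finset.mem_range.1 hi; omega) _), ?_⟩
  -- The `i = 0` term is the top component, hence the symbol of `q(a) ∘ q(b)`, which is `a · b`.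
  have h0 : Q.component (n + m) (n + m - 0) (X.diffComp n m (Q.q n a) (Q.q m b)) =
      X.symbMul a b := by
    rw [← Q.symbol_q n a, ← Q.symbol_q m b, symbMul_symbol, Q.symbol_q, Q.symbol_q]
    exact Q.component_self _ _
  rw [starHom_apply, Finset.sum_range_succ', h0, Finset.smul_sum, pow_zero]
  refine (add_sub_cancel_right _ _).trans (Finset.sum_congr rfl fun i _ => ?_)
  rw [TensorProduct.smul_tmul', smul_eq_mul, pow_succ']

end FullQuantization

/-! ### Evaluation of the deformation parameter -/

section Evaluation

variable (ħ : k)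

theorem evalAt_one_tmul (s : X.SymbAlg E) : X.evalAt E ħ (1 ⊗ₜ s) = s := by
  rw [evalAt_tmul, Polynomial.eval_one, one_smul]

theorem evalAt_surjective : Function.Surjective (X.evalAt E ħ) := fun s =>
  ⟨1 ⊗ₜ s, evalAt_one_tmul ħ s⟩

theorem evalAt_smul (p : k[X]) (x : X.SymbPoly E) :
    X.evalAt E ħ (p • x) = p.eval ħ • X.evalAt E ħ x := by
  induction x using TensorProduct.induction_on with
  | zero => simp
  | tmul r s =>
    rw [TensorProduct.smul_tmul', evalAt_tmul, evalAt_tmul, smul_eq_mul, Polynomial.eval_mul,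
      mul_smul]
  | add x y hx hy => rw [smul_add, map_add, map_add, smul_add, hx, hy]

/-- Modulo multiples of `h - ħ`, every element of `Symb[h]` is congruent to its value at `ħ`. -/
theorem exists_sub_evalAt_eq_smul (x : X.SymbPoly E) :
    ∃ y : X.SymbPoly E,
      x - 1 ⊗ₜ X.evalAt E ħ x = (Polynomial.X - Polynomial.C ħ : k[X]) • y := by
  induction x using TensorProduct.induction_on with
  | zero => exact ⟨0, by simp⟩
  | tmul p s =>
    -- Factor theorem: `h - ħ` divides `p - p(ħ)`.
    obtain ⟨g, hg⟩ := Polynomial.X_sub_C_dvd_sub_C_eval (a := ħ) (p := p)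
    refine ⟨g ⊗ₜ s, ?_⟩
    rw [evalAt_tmul, TensorProduct.smul_tmul', smul_eq_mul, ← hg, TensorProduct.sub_tmul,
      ← TensorProduct.smul_tmul, ← Polynomial.C_mul', mul_one]
  | add x y hx hy =>
    obtain ⟨x', hx⟩ := hx
    obtain ⟨y', hy⟩ := hy
    refine ⟨x' + y', ?_⟩
    rw [smul_add, ← hx, ← hy, map_add, TensorProduct.tmul_add]
    abel

theorem evalAt_mem_symbLT {N : ℕ} {x : X.SymbPoly E}
    (hx : x ∈ (X.symbLT E N).baseChange k[X]) : X.evalAt E ħ x ∈ X.symbLT E N := by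
  rw [Submodule.baseChange_eq_span] at hx
  induction hx using Submodule.span_induction with
  | mem x h =>
    obtain ⟨s, hs, rfl⟩ := h
    change X.evalAt E ħ (1 ⊗ₜ s) ∈ _
    rwa [evalAt_one_tmul]
  | zero => rw [map_zero]; exact zero_mem _
  | add x y _ _ hx hy => rw [map_add]; exact add_mem hx hy
  | smul p x _ hx => rw [evalAt_smul]; exact Submodule.smul_mem _ _ hx

theorem map_evalAt_baseChange_symbLT (N : ℕ) :
    (((X.symbLT E N).baseChange k[X]).restrictScalars k).map (X.evalAt E ħ) = X.symbLT E N := by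
  refine le_antisymm ?_ fun s hs =>
    ⟨1 ⊗ₜ s, Submodule.tmul_mem_baseChange_of_mem 1 hs, evalAt_one_tmul ħ s⟩
  rintro _ ⟨x, hx, rfl⟩
  exact evalAt_mem_symbLT ħ hx

namespace FullQuantization

variable (Q : X.FullQuantization E E)

theorem starAt_apply (s t : X.SymbAlg E) :
    Q.starAt ħ s t = X.evalAt E ħ (Q.star s t) := rfl

/-- Both sides pull polynomial coefficients out as their values at `ħ`, and on constants this is the
definition of `starAt`. With surjectivity, every identity of the formal product descends to `⋆_ħ`.
-/
theorem evalAt_formalStar (x y : X.SymbPoly E) :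
    X.evalAt E ħ (Q.formalStar x y) = Q.starAt ħ (X.evalAt E ħ x) (X.evalAt E ħ y) := by
  induction x using TensorProduct.induction_on with
  | zero => simp
  | add x x' hx hx' => simp only [map_add, LinearMap.add_apply, hx, hx']
  | tmul p s =>
    induction y using TensorProduct.induction_on with
    | zero => simp
    | add y y' hy hy' => simp only [map_add, hy, hy']
    | tmul r t =>
      rw [formalStar_tmul, evalAt_smul, evalAt_tmul, evalAt_tmul, map_smul, map_smul,
        LinearMap.smul_apply, starAt_apply, Polynomial.eval_mul, mul_comm, mul_smul]

theorem isFilteredAlgebra_starAt :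
    IsFilteredAlgebra (Q.starAt ħ) (X.symbOne E) (fun n => X.symbLT E (n + 1)) where
  mul_assoc a b c := by
    obtain ⟨x, rfl⟩ := evalAt_surjective ħ a
    obtain ⟨y, rfl⟩ := evalAt_surjective ħ b
    obtain ⟨z, rfl⟩ := evalAt_surjective ħ c
    simp only [← evalAt_formalStar, formalStar_assoc]
  one_mul a := by
    obtain ⟨x, rfl⟩ := evalAt_surjective ħ a
    rw [← evalAt_one_tmul ħ (X.symbOne E), ← evalAt_formalStar, one_formalStar]
  mul_one a := by
    obtain ⟨x, rfl⟩ := evalAt_surjective ħ a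
    rw [← evalAt_one_tmul ħ (X.symbOne E), ← evalAt_formalStar, formalStar_one]
  mono _ _ h := symbLT_mono (Nat.succ_le_succ h)
  exhaustive := symbLT_exhaustive
  one_mem := symbOne_mem
  mul_mem hs ht := evalAt_mem_symbLT ħ (Q.star_mem hs ht)

/-- The kernel of the evaluation at `ħ` is the two-sided ideal generated by `h - ħ`. -/
theorem mem_twoSidedIdeal_iff (x : X.SymbPoly E) :
    x ∈ twoSidedIdeal Q.formalStar
        ((Polynomial.X - Polynomial.C ħ : k[X]) ⊗ₜ[k] X.symbOne E) ↔ X.evalAt E ħ x = 0 := by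
  constructor
  -- The kernel of evaluation is a two-sided ideal containing `h - ħ`. As `evalAt` is only
  -- `k`-linear, its kernel is made a `k[X]`-submodule by hand.
  · let K : Submodule k[X] (X.SymbPoly E) :=
      { carrier := {y | X.evalAt E ħ y = 0}
        zero_mem' := map_zero _
        add_mem' := fun {y z} (hy : _ = _) (hz : _ = _) =>
          show X.evalAt E ħ (y + z) = 0 by rw [map_add, hy, hz, add_zero]
        smul_mem' := fun p y (hy : _ = _) =>
          show X.evalAt E ħ (p • y) = 0 by rw [evalAt_smul, hy, smul_zero] }
    intro hx
    refine Submodule.mem_sInf.1 hx K ⟨?_, fun a (ha : _ = _) b => ⟨?_, ?_⟩⟩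
    · change X.evalAt E ħ _ = 0
      rw [evalAt_tmul]
      simp
    · change X.evalAt E ħ _ = 0
      rw [evalAt_formalStar, ha, map_zero, LinearMap.zero_apply]
    · change X.evalAt E ħ _ = 0
      rw [evalAt_formalStar, ha, map_zero]
  · intro hx
    obtain ⟨y, hy⟩ := exists_sub_evalAt_eq_smul ħ x
    rw [hx, TensorProduct.tmul_zero, sub_zero] at hy
    refine Submodule.mem_sInf.2 fun I hI => ?_
    -- Here `x = (h - ħ) y` is the star product of the generator with `y`, by the unit law, so it
    -- lies in every ideal `I` containing the generator.
    have h := (hI.2 _ hI.1 y).1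
    rwa [← mul_one (Polynomial.X - Polynomial.C ħ : k[X]), ← smul_eq_mul,
      ← TensorProduct.smul_tmul', map_smul, LinearMap.smul_apply, one_formalStar, ← hy] at h

/-- The isomorphism from the quotient of `Symb[h]` by the ideal generated by `h - ħ` onto
`Symb`. -/
def quotientEquiv :
    (X.SymbPoly E ⧸ twoSidedIdeal Q.formalStar
      ((Polynomial.X - Polynomial.C ħ : k[X]) ⊗ₜ[k] X.symbOne E)) ≃ₗ[k] X.SymbAlg E :=
  -- The ideal is a `k[X]`-submodule and the kernel a `k`-submodule, so they are compared after
  -- restriction of scalars.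
  (Submodule.quotEquivOfEq _ _ (Submodule.ext (Q.mem_twoSidedIdeal_iff ħ)) :
    (X.SymbPoly E ⧸ (twoSidedIdeal Q.formalStar
      ((Polynomial.X - Polynomial.C ħ : k[X]) ⊗ₜ[k] X.symbOne E)).restrictScalars k) ≃ₗ[k]
      X.SymbPoly E ⧸ LinearMap.ker (X.evalAt E ħ)) ≪≫ₗ
    (X.evalAt E ħ).quotKerEquivOfSurjective (evalAt_surjective ħ)

theorem quotientEquiv_mk (x : X.SymbPoly E) :
    Q.quotientEquiv ħ (Submodule.Quotient.mk x) = X.evalAt E ħ x := rfl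

end FullQuantization

end Evaluation

end ExteriorCalculus

end NCJet

end

/-! ### The theorem -/

open NCJet ExteriorCalculus in
theorem proposition5p35 {k : Type v} {A : Type u} {Ω : Type w} [CommRing k] [Ring A]
    [Algebra k A] [Ring Ω] [Algebra k Ω] (X : ExteriorCalculus k A Ω)
    (E : Type u) [AddCommGroup E] [Module k E] [Module A E] [IsScalarTower k A E]
    (Q : X.FullQuantization E E) :
    -- the formal star product
    IsFilteredAlgebra Q.formalStar (1 ⊗ₜ[k] X.symbOne E)
        (fun n => (X.symbLT E (n + 1)).baseChange k[X]) ∧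
      (∀ (n m : ℕ) (a : X.Symb E E n) (b : X.Symb E E m),
        ∃ r ∈ (X.symbLT E (n + m)).baseChange k[X],
          Q.formalStar (1 ⊗ₜ[k] X.symbOf n a) (1 ⊗ₜ[k] X.symbOf m b) -
              1 ⊗ₜ[k] X.symbOf (n + m) (X.symbMul a b) = (Polynomial.X : k[X]) • r) ∧
      -- the star product with parameter
      ∀ ħ : k,
        IsFilteredAlgebra (Q.starAt ħ) (X.symbOne E) (fun n => X.symbLT E (n + 1)) ∧
        (∀ n : ℕ, X.symbLT E (n + 1) =
          (((X.symbLT E (n + 1)).baseChange k[X]).restrictScalars k).map (X.evalAt E ħ)) ∧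
        (∃ φ : (X.SymbPoly E ⧸ twoSidedIdeal Q.formalStar
              ((Polynomial.X - Polynomial.C ħ : k[X]) ⊗ₜ[k] X.symbOne E)) ≃ₗ[k] X.SymbAlg E,
          (∀ x : X.SymbPoly E, φ (Submodule.Quotient.mk x) = X.evalAt E ħ x) ∧
          φ (Submodule.Quotient.mk (1 ⊗ₜ[k] X.symbOne E)) = X.symbOne E ∧
          ∀ x y : X.SymbPoly E, φ (Submodule.Quotient.mk (Q.formalStar x y)) =
            Q.starAt ħ (φ (Submodule.Quotient.mk x)) (φ (Submodule.Quotient.mk y))) ∧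
        ∀ (n m : ℕ) (a : X.Symb E E n) (b : X.Symb E E m),
          ∃ r ∈ X.symbLT E (n + m),
            Q.starAt ħ (X.symbOf n a) (X.symbOf m b) - X.symbOf (n + m) (X.symbMul a b) =
              ħ • r := by
  have hdef : ∀ (n m : ℕ) (a : X.Symb E E n) (b : X.Symb E E m),
      Q.formalStar (1 ⊗ₜ[k] X.symbOf n a) (1 ⊗ₜ[k] X.symbOf m b) = Q.starHom n m a b := by
    intro n m a b
    rw [Q.formalStar_tmul, Q.star_symbOf, one_mul, one_smul]
  refine ⟨Q.isFilteredAlgebra_formalStar, fun n m a b => ?_, fun ħ =>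
    ⟨Q.isFilteredAlgebra_starAt ħ, fun n => (map_evalAt_baseChange_symbLT ħ (n + 1)).symm,
      ⟨Q.quotientEquiv ħ, Q.quotientEquiv_mk ħ, evalAt_one_tmul ħ _, Q.evalAt_formalStar ħ⟩,
      fun n m a b => ?_⟩⟩
  · rw [hdef]
    exact Q.exists_starHom_sub_symbMul n m a b
  -- Evaluation turns the formal deformation identity into the one for `ħ`: the factor `h` becomes
  -- `ħ`, and the remainder keeps its filtration degree.
  · obtain ⟨r, hr, h⟩ := Q.exists_starHom_sub_symbMul n m a b
    refine ⟨X.evalAt E ħ r, evalAt_mem_symbLT ħ hr, ?_⟩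
    have h := congrArg (X.evalAt E ħ) h
    rwa [map_sub, evalAt_one_tmul, evalAt_smul, Polynomial.eval_X, ← Q.star_symbOf] at h
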